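/- Let $\mathcal D$ be the variety of bounded distributive lattices (with $0,1$ in the type) and $\mathbf 2$ its two-element chain. For $\mathbf K\in\mathcal D$ let $\mathsf H(\mathbf K)=\mathcal D(\mathbf K,\mathbf 2)$ be its Priestley dual space, with the pointwise order and the topology of pointwise convergence; $\mathsf H$ acts on morphisms by $\mathsf H(g)\colon p\mapsto p\circ g$. Let $\mathbf M$ be a finite algebra having a (term-)reduct in $\mathcal D$, let $\mathcal A=\mathbb{ISP}(\mathbf M)$ be the category of all algebras isomorphic to subalgebras of powers of $\mathbf M$, with all homomorphisms as morphisms, and let $\mathsf U\colon\mathcal A\to\mathcal D$ be the forgetful functor taking each algebra to its $\mathcal D$-reduct. Put $\Omega=\mathsf{HU}(\mathbf M)=\mathcal D(\mathsf U(\mathbf M),\mathbf 2)$. For $\omega_1,\omega_2\in\Omega$ let $R_{\omega_1,\omega_2}$ be the set of those subalgebras of $\mathbf M^2$ that are maximal among the subalgebras contained in $\{(a,b)\in M^2\mid \omega_1(a)\le\omega_2(b)\}$. For $\mathbf A\in\mathcal A$ let $\mathsf D(\mathbf A)=\mathcal A(\mathbf A,\mathbf M)$, topologised as a subspace of $M^A$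 with $M$ discrete, and for $h\in\mathcal A(\mathbf A,\mathbf B)$ let $\mathsf D(h)\colon\mathsf D(\mathbf B)\to\mathsf D(\mathbf A)$, $x\mapsto x\circ h$. Let $Y_{\mathbf A}=\mathsf D(\mathbf A)\times\Omega$ with the product topology, $\Omega$ being discrete, and define $(x,\omega_1)\preccurlyeq(y,\omega_2)$ to mean that there is $r\in R_{\omega_1,\omega_2}$ with $(x(a),y(a))\in r$ for all $a\in A$. The relation $\preccurlyeq$ is a pre-order on $Y_{\mathbf A}$; let $\approx\;=\;\preccurlyeq\cap\succcurlyeq$. **Theorem.** There is a well-defined contravariant functor $\mathsf L$ from $\mathcal A$ to the category of Priestley spaces and continuous order-preserving maps, given on objects by letting $\mathsf L(\mathbf A)$ be $Y_{\mathbf A}/_{\approx}$ with the partial order $\preccurlyeq/_{\approx}$ and the quotient topology, and on morphisms $h\colon\mathbf A\to\mathbf B$ by $$\mathsf L(h)\colon \mathsf L(\mathbf B)\to\mathsf L(\mathbf A),\qquad [(x,\omega)]_{\approx}\mapsto[(\mathsf D(h)(x),\omega)]_{\approx}.$$ Moreover the maps $\Phi_{\mathbf A}\colon\mathsf L(\mathbf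 A)\to\mathsf{HU}(\mathbf A)$, $[(x,\omega)]_{\approx}\mapsto\omega\circ x$, are well defined and form a natural isomorphism between $\mathsf L$ and $\mathsf{HU}$. -/

import Mathlib

open CategoryTheory Opposite
open scoped FirstOrder

universe u v w

/-! ### Products of algebras -/

/-- The product structure on a family of structures: all symbols are interpreted coordinatewise. -/
instance piStructure (L : FirstOrder.Language.{u, v}) {ι : Type*} (N : ι → Type*)
    [∀ i, L.Structure (N i)] : L.Structure (∀ i, N i) where
  funMap f a := fun i => FirstOrder.Language.Structure.funMap f fun k => a k i
  RelMap r a := ∀ i, FirstOrder.Language.Structure.RelMap r fun k => a k i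

/-- The product structure on a product of two structures. -/
instance prodStructure (L : FirstOrder.Language.{u, v}) (N P : Type*)
    [L.Structure N] [L.Structure P] : L.Structure (N × P) where
  funMap f a := (FirstOrder.Language.Structure.funMap f fun k => (a k).1,
    FirstOrder.Language.Structure.funMap f fun k => (a k).2)
  RelMap r a := (FirstOrder.Language.Structure.RelMap r fun k => (a k).1) ∧
    FirstOrder.Language.Structure.RelMap r fun k => (a k).2

/-! ### Reducts in the variety of bounded distributive lattices -/

/-- A choice of two binary and two nullary terms of the language, to be interpreted as the
operations `∨`, `∧`, `0`, `1` (the terms may in particular be basic operation symbols). -/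
structure LatticeTerms (L : FirstOrder.Language.{u, v}) where
  sup : L.Term (Fin 2)
  inf : L.Term (Fin 2)
  bot : L.Term (Fin 0)
  top : L.Term (Fin 0)

namespace LatticeTerms

variable {L : FirstOrder.Language.{u, v}} (T : LatticeTerms L)

/-- The join operation on `A` given by the term `T.sup`. -/
def supOp (A : Type*) [L.Structure A] (a b : A) : A := T.sup.realize ![a, b]

/-- The meet operation on `A` given by the term `T.inf`. -/
def infOp (A : Type*) [L.Structure A] (a b : A) : A := T.inf.realize ![a, b]

/-- The least element of `A` given by the term `T.bot`. -/
def botOp (A : Type*) [L.Structure A] : A := T.bot.realize ![]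

/-- The greatest element of `A` given by the term `T.top`. -/
def topOp (A : Type*) [L.Structure A] : A := T.top.realize ![]

/-- `(A; ∨, ∧, 0, 1)`, with the operations given by the terms `T`, is a bounded distributive
lattice. -/
structure IsReduct (A : Type*) [L.Structure A] : Prop where
  sup_comm : ∀ a b : A, T.supOp A a b = T.supOp A b a
  sup_assoc : ∀ a b c : A, T.supOp A (T.supOp A a b) c = T.supOp A a (T.supOp A b c)
  inf_comm : ∀ a b : A, T.infOp A a b = T.infOp A b a
  inf_assoc : ∀ a b c : A, T.infOp A (T.infOp A a b) c = T.infOp A a (T.infOp A b c)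
  sup_inf_self : ∀ a b : A, T.supOp A a (T.infOp A a b) = a
  inf_sup_self : ∀ a b : A, T.infOp A a (T.supOp A a b) = a
  inf_sup_left : ∀ a b c : A,
    T.infOp A a (T.supOp A b c) = T.supOp A (T.infOp A a b) (T.infOp A a c)
  bot_sup : ∀ a : A, T.supOp A (T.botOp A) a = a
  sup_top : ∀ a : A, T.supOp A a (T.topOp A) = T.topOp A

variable {T}

/-- The distributive lattice on the carrier of `A` with operations given by the terms `T`. -/
@[reducible]
def IsReduct.distribLattice {A : Type*} [L.Structure A] (h : T.IsReduct A) : DistribLattice A :=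
  letI : Max A := ⟨T.supOp A⟩
  letI : Min A := ⟨T.infOp A⟩
  letI : Lattice A := Lattice.mk' h.sup_comm h.sup_assoc h.inf_comm h.inf_assoc
    h.sup_inf_self h.inf_sup_self
  DistribLattice.ofInfSupLe fun a b c => le_of_eq (h.inf_sup_left a b c)

/-- The bounds `0`, `1` of the lattice `IsReduct.distribLattice`. -/
@[reducible]
def IsReduct.boundedOrder {A : Type*} [L.Structure A] (h : T.IsReduct A) :
    letI := h.distribLattice
    BoundedOrder A :=
  letI := h.distribLattice
  { bot := T.botOp A
    top := T.topOp A
    bot_le := fun a => sup_eq_right.mp (h.bot_sup a)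
    le_top := fun a => sup_eq_right.mp (h.sup_top a) }

/-- The reduct of `A` as an object of the category of bounded distributive lattices. -/
def IsReduct.toBddDistLat {A : Type w} [L.Structure A] (h : T.IsReduct A) : BddDistLat.{w} :=
  letI := h.distribLattice
  letI := h.boundedOrder
  BddDistLat.of A

section Hom

variable (T) {A B : Type*} [L.Structure A] [L.Structure B] (f : A →[L] B)

theorem map_supOp (a b : A) : f (T.supOp A a b) = T.supOp B (f a) (f b) := by
  unfold supOp
  rw [← FirstOrder.Language.HomClass.realize_term f]
  congr 1
  funext i
  fin_cases i <;> rfl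

theorem map_infOp (a b : A) : f (T.infOp A a b) = T.infOp B (f a) (f b) := by
  unfold infOp
  rw [← FirstOrder.Language.HomClass.realize_term f]
  congr 1
  funext i
  fin_cases i <;> rfl

theorem map_botOp : f (T.botOp A) = T.botOp B := by
  unfold botOp
  rw [← FirstOrder.Language.HomClass.realize_term f]
  congr 1
  funext i
  exact i.elim0

theorem map_topOp : f (T.topOp A) = T.topOp B := by
  unfold topOp
  rw [← FirstOrder.Language.HomClass.realize_term f]
  congr 1
  funext i
  exact i.elim0

/-- A homomorphism of algebras is a homomorphism of the bounded distributive lattice reducts. -/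
def IsReduct.mapHom {A B : Type w} [L.Structure A] [L.Structure B] (hA : T.IsReduct A)
    (hB : T.IsReduct B) (f : A →[L] B) : hA.toBddDistLat ⟶ hB.toBddDistLat :=
  letI := hA.distribLattice
  letI := hA.boundedOrder
  letI := hB.distribLattice
  letI := hB.boundedOrder
  BddDistLat.ofHom
    { toFun := f
      map_sup' := T.map_supOp f
      map_inf' := T.map_infOp f
      map_top' := T.map_topOp f
      map_bot' := T.map_botOp f }

end Hom

/-- The defining identities pass to every algebra whose homomorphisms into `M` separate points. -/
theorem IsReduct.of_separating {A M : Type*} [L.Structure A] [L.Structure M]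
    (h : T.IsReduct M) (sep : ∀ a b : A, (∀ x : A →[L] M, x a = x b) → a = b) :
    T.IsReduct A where
  sup_comm a b := sep _ _ fun x => by simp only [map_supOp]; exact h.sup_comm _ _
  sup_assoc a b c := sep _ _ fun x => by simp only [map_supOp]; exact h.sup_assoc _ _ _
  inf_comm a b := sep _ _ fun x => by simp only [map_infOp]; exact h.inf_comm _ _
  inf_assoc a b c := sep _ _ fun x => by simp only [map_infOp]; exact h.inf_assoc _ _ _
  sup_inf_self a b := sep _ _ fun x => by
    simp only [map_supOp, map_infOp]; exact h.sup_inf_self _ _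
  inf_sup_self a b := sep _ _ fun x => by
    simp only [map_supOp, map_infOp]; exact h.inf_sup_self _ _
  inf_sup_left a b c := sep _ _ fun x => by
    simp only [map_supOp, map_infOp]; exact h.inf_sup_left _ _ _
  bot_sup a := sep _ _ fun x => by simp only [map_supOp, map_botOp]; exact h.bot_sup _
  sup_top a := sep _ _ fun x => by simp only [map_supOp, map_topOp]; exact h.sup_top _

end LatticeTerms

/-! ### The quasivariety generated by one algebra -/

/-- `A` is isomorphic to a subalgebra of a power of `M`. (An index type in the universe of `A` is
no restriction: at most one coordinate is needed for each pair of distinct elements of `A`.) -/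
def IsISP (L : FirstOrder.Language.{u, v}) (M : Type w) [L.Structure M]
    (A : Type w) [L.Structure A] : Prop :=
  ∃ ι : Type w, Nonempty (A ↪[L] (ι → M))

/-- The algebras in `ISP(M)`. -/
structure ISPAlg (L : FirstOrder.Language.{u, v}) (M : Type w) [L.Structure M] where
  carrier : Type w
  [str : L.Structure carrier]
  mem : IsISP L M carrier

namespace ISPAlg

variable {L : FirstOrder.Language.{u, v}} {M : Type w} [L.Structure M]

instance : CoeSort (ISPAlg L M) (Type w) := ⟨ISPAlg.carrier⟩

instance (A : ISPAlg L M) : L.Structure A := A.str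

/-- The category `ISP(M)`: the morphisms are all homomorphisms. -/
instance : Category (ISPAlg L M) where
  Hom A B := A →[L] B
  id A := FirstOrder.Language.Hom.id L A
  comp f g := FirstOrder.Language.Hom.comp g f

theorem separating (A : ISPAlg L M) (a b : A) (hab : ∀ x : A →[L] M, x a = x b) : a = b := by
  obtain ⟨ι, ⟨f⟩⟩ := A.mem
  apply f.injective
  funext i
  exact hab
    { toFun := fun c => f c i
      map_fun' := fun g c => congrFun (f.map_fun g c) i
      map_rel' := fun r c hc => (f.map_rel r c).mpr hc i }

theorem isReduct (A : ISPAlg L M) {T : LatticeTerms L} (hM : T.IsReduct M) : T.IsReduct A :=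
  hM.of_separating A.separating

end ISPAlg

/-- The forgetful functor `U` from `ISP(M)` to bounded distributive lattices, which is the
identity on underlying sets and maps. -/
def forgetU {L : FirstOrder.Language.{u, v}} {M : Type w} [L.Structure M] {T : LatticeTerms L}
    (hM : T.IsReduct M) : ISPAlg L M ⥤ BddDistLat.{w} where
  obj A := (A.isReduct hM).toBddDistLat
  map {A B} h := LatticeTerms.IsReduct.mapHom T (A.isReduct hM) (B.isReduct hM) h
  map_id _ := rfl
  map_comp _ _ := rfl

/-! ### Priestley spaces and Priestley duality -/

/-- Priestley spaces. -/
structure PriestleyCat where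
  carrier : Type w
  [top : TopologicalSpace carrier]
  [ord : PartialOrder carrier]
  [compact : CompactSpace carrier]
  [priestley : PriestleySpace carrier]

namespace PriestleyCat

instance : CoeSort PriestleyCat.{w} (Type w) := ⟨PriestleyCat.carrier⟩

attribute [instance] PriestleyCat.top PriestleyCat.ord PriestleyCat.compact
  PriestleyCat.priestley

/-- The morphisms of Priestley spaces are the continuous order-preserving maps. -/
instance : Category PriestleyCat.{w} where
  Hom X Y := X →Co Y
  id X := ContinuousOrderHom.id X
  comp f g := ContinuousOrderHom.comp g f

instance : ConcreteCategory PriestleyCat.{w} (fun X Y => X →Co Y) where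
  hom f := f
  ofHom f := f

end PriestleyCat

/-- The set `D(K, 2)` of bounded lattice homomorphisms into the two-element chain `{0, 1}`. -/
def DualPoint (K : BddDistLat.{w}) : Type w := BoundedLatticeHom K Bool

namespace DualPoint

variable (K : BddDistLat.{w})

instance : FunLike (DualPoint K) K Bool :=
  inferInstanceAs (FunLike (BoundedLatticeHom K Bool) K Bool)

/-- The pointwise order. -/
instance : PartialOrder (DualPoint K) :=
  PartialOrder.lift (fun p => (p : K → Bool)) DFunLike.coe_injective

/-- The topology of pointwise convergence, i.e. the subspace topology from the power of the
discrete two-point space. -/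
instance : TopologicalSpace (DualPoint K) :=
  TopologicalSpace.induced (fun p => (p : K → Bool)) inferInstance

theorem isClosed_range : IsClosed (Set.range fun p : DualPoint K => (p : K → Bool)) := by
  have h : (Set.range fun p : DualPoint K => (p : K → Bool)) =
      ({f | f ⊤ = true} ∩ {f | f ⊥ = false}) ∩
        ((⋂ a : K, ⋂ b : K, {f | f (a ⊔ b) = (f a ⊔ f b)}) ∩
          ⋂ a : K, ⋂ b : K, {f | f (a ⊓ b) = (f a ⊓ f b)}) := by
    ext f
    simp only [Set.mem_range, Set.mem_inter_iff, Set.mem_iInter, Set.mem_ofPred_eq]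
    constructor
    · rintro ⟨p, rfl⟩
      exact ⟨⟨BoundedLatticeHom.map_top' p, BoundedLatticeHom.map_bot' p⟩,
        p.map_sup', p.map_inf'⟩
    · rintro ⟨⟨h1, h0⟩, hs, hi⟩
      exact ⟨({ toFun := f, map_sup' := hs, map_inf' := hi, map_top' := h1,
                map_bot' := h0 } : BoundedLatticeHom K Bool), rfl⟩
  rw [h]
  refine ((isClosed_eq (continuous_apply _) continuous_const).inter
    (isClosed_eq (continuous_apply _) continuous_const)).inter
    ((isClosed_iInter fun a => isClosed_iInter fun b => ?_).inter
      (isClosed_iInter fun a => isClosed_iInter fun b => ?_))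
  · exact isClosed_eq (continuous_apply _)
      (Continuous.comp (g := fun q : Bool × Bool => q.1 ⊔ q.2)
        (f := fun f : K → Bool => (f a, f b)) continuous_of_discreteTopology
        ((continuous_apply a).prodMk (continuous_apply b)))
  · exact isClosed_eq (continuous_apply _)
      (Continuous.comp (g := fun q : Bool × Bool => q.1 ⊓ q.2)
        (f := fun f : K → Bool => (f a, f b)) continuous_of_discreteTopology
        ((continuous_apply a).prodMk (continuous_apply b)))

instance : CompactSpace (DualPoint K) :=
  (Topology.IsClosedEmbedding.mk
    ⟨⟨rfl⟩, DFunLike.coe_injective⟩ (isClosed_range K)).compactSpace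

theorem continuous_eval (a : K) : Continuous fun p : DualPoint K => p a :=
  (continuous_apply a).comp continuous_induced_dom

instance : PriestleySpace (DualPoint K) where
  priestley {p q} hpq := by
    have hne : ∃ a, ¬ p a ≤ q a := by
      by_contra hcon
      push Not at hcon
      exact hpq hcon
    obtain ⟨a, ha⟩ := hne
    refine ⟨{r | r a = true}, ?_, ?_, ?_, ?_⟩
    · exact (isClopen_discrete {true}).preimage (continuous_eval K a)
    · intro r s hrs hr
      have h1 : r a ≤ s a := hrs a
      have h2 : r a = true := hr
      rw [h2] at h1
      exact top_le_iff.mp h1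
    · show p a = true
      revert ha
      cases p a <;> cases q a <;> decide
    · show ¬ q a = true
      revert ha
      cases p a <;> cases q a <;> decide

end DualPoint

/-- The Priestley dual functor `H = D(-, 2)`, acting on morphisms by precomposition. -/
noncomputable def priestleyH : BddDistLat.{w}ᵒᵖ ⥤ PriestleyCat.{w} where
  obj K := { carrier := DualPoint K.unop }
  map {K K'} f :=
    { toFun := fun p => (BoundedLatticeHom.comp p f.unop.hom : BoundedLatticeHom K'.unop Bool)
      monotone' := fun _ _ hpq a => hpq (f.unop a)
      continuous_toFun := continuous_induced_rng.mpr
        (continuous_pi fun a => DualPoint.continuous_eval K.unop (f.unop a)) }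
  map_id _ := rfl
  map_comp _ _ := rfl

/-! ### The natural dual and the piggyback relations -/

section Piggyback

variable {L : FirstOrder.Language.{u, v}} {M : Type w} [L.Structure M]

/-- The underlying set of the natural dual `D(A)`: all homomorphisms from `A` to `M`. -/
def NatDual (A : ISPAlg L M) : Type w := A →[L] M

instance (A : ISPAlg L M) : FunLike (NatDual A) A M :=
  inferInstanceAs (FunLike (A →[L] M) A M)

/-- `D(A)` is topologised as a subspace of the power `M ^ A`, with `M` discrete. -/
instance (A : ISPAlg L M) : TopologicalSpace (NatDual A) :=
  TopologicalSpace.induced (fun x => (x : A → M)) (@Pi.topologicalSpace A (fun _ => M) fun _ => ⊥)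

/-- The action of `D` on morphisms, `D(h) : x ↦ x ∘ h`. -/
def NatDual.map {A B : ISPAlg L M} (h : A ⟶ B) (x : NatDual B) : NatDual A :=
  FirstOrder.Language.Hom.comp (x : B →[L] M) (h : A →[L] B)

/-- The pointwise lifting `r^{D(A)}` of a binary relation `r` on `M` to `D(A)`. -/
def liftRel (A : ISPAlg L M) (r : Set (M × M)) (x y : NatDual A) : Prop :=
  ∀ a : A, (x a, y a) ∈ r

variable {T : LatticeTerms L} (hM : T.IsReduct M)

/-- `Ω = HU(M)`, the set of bounded lattice homomorphisms from the reduct of `M` into `2`. -/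
abbrev Omega : Type w := DualPoint hM.toBddDistLat

instance : FunLike (Omega hM) M Bool :=
  inferInstanceAs (FunLike (DualPoint hM.toBddDistLat) hM.toBddDistLat Bool)

/-- `R_{ω₁,ω₂}`: the subalgebras of `M²` that are maximal among those contained in
`{(a, b) | ω₁(a) ≤ ω₂(b)}`. -/
def piggyRel (ω₁ ω₂ : Omega hM) : Set (L.Substructure (M × M)) :=
  {r | Maximal (fun s : L.Substructure (M × M) =>
    (s : Set (M × M)) ⊆ {p | ω₁ p.1 ≤ ω₂ p.2}) r}

/-- The set `Y_A = D(A) × Ω`. -/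
def PiggyY (A : ISPAlg L M) : Type w := NatDual A × Omega hM

/-- The element `(x, ω)` of `Y_A`. -/
def PiggyY.mk {A : ISPAlg L M} (x : NatDual A) (ω : Omega hM) : PiggyY hM A := (x, ω)

/-- The topology on `Y_A` is the product topology with `Ω` discrete. -/
instance (A : ISPAlg L M) : TopologicalSpace (PiggyY hM A) :=
  @instTopologicalSpaceProd (NatDual A) (Omega hM) inferInstance ⊥

/-- `(x, ω₁) ≼ (y, ω₂)` if and only if `(x, y) ∈ r^{D(A)}` for some `r ∈ R_{ω₁,ω₂}`. -/
def piggyLE {A : ISPAlg L M} (p q : PiggyY hM A) : Prop :=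
  ∃ r ∈ piggyRel hM p.2 q.2, liftRel A (r : Set (M × M)) p.1 q.1

theorem piggyLE_iff [L.IsAlgebraic] [Finite M] {A : ISPAlg L M} (p q : PiggyY hM A) :
    piggyLE hM p q ↔ ∀ a : A, p.2 (p.1 a) ≤ q.2 (q.1 a) := by
  constructor
  · rintro ⟨r, hr, hxy⟩ a
    have hr' : Maximal (fun s : L.Substructure (M × M) =>
        (s : Set (M × M)) ⊆ {s | p.2 s.1 ≤ q.2 s.2}) r := hr
    exact hr'.prop (hxy a)
  · intro h
    have : Finite (L.Substructure (M × M)) :=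
      Finite.of_injective (fun s => (s : Set (M × M))) SetLike.coe_injective
    let g : A →[L] (M × M) :=
      { toFun := fun a => (p.1 a, q.1 a)
        map_fun' := fun f a =>
          Prod.ext (FirstOrder.Language.Hom.map_fun p.1 f a)
            (FirstOrder.Language.Hom.map_fun q.1 f a)
        map_rel' := fun r a _ => isEmptyElim r }
    have hg : ((g.range : L.Substructure (M × M)) : Set (M × M)) ⊆
        {s | p.2 s.1 ≤ q.2 s.2} := by
      rw [FirstOrder.Language.Hom.range_coe]
      rintro _ ⟨a, rfl⟩
      exact h a
    obtain ⟨r, hr, hmax⟩ := Set.Finite.exists_le_maximal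
      (Set.toFinite {s : L.Substructure (M × M) |
        (s : Set (M × M)) ⊆ {s | p.2 s.1 ≤ q.2 s.2}}) hg
    exact ⟨r, hmax, fun a => hr (g.mem_range_self a)⟩

/-- The relation `≼` is a pre-order. -/
instance [L.IsAlgebraic] [Finite M] (A : ISPAlg L M) : Preorder (PiggyY hM A) where
  le := piggyLE hM
  le_refl p := (piggyLE_iff hM p p).mpr fun _ => le_rfl
  le_trans p q s hpq hqs := (piggyLE_iff hM p s).mpr fun a =>
    ((piggyLE_iff hM p q).mp hpq a).trans ((piggyLE_iff hM q s).mp hqs a)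

/-- The composite `ω ∘ x`, as a bounded lattice homomorphism from `U(A)` to `2`. -/
noncomputable def NatDual.compOmega {A : ISPAlg L M} (x : NatDual A) (ω : Omega hM) :
    DualPoint ((forgetU hM).obj A) :=
  (BoundedLatticeHom.comp ω (LatticeTerms.IsReduct.mapHom T (A.isReduct hM) hM x).hom :
    BoundedLatticeHom ((forgetU hM).obj A) Bool)

theorem NatDual.coe_compOmega {A : ISPAlg L M} (x : NatDual A) (ω : Omega hM) :
    (NatDual.compOmega hM x ω : A → Bool) = (ω : M → Bool) ∘ (x : A → M) := rfl

variable [L.IsAlgebraic] [Finite M]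

/-- The quotient `Y_A / ≈`, where `≈` is `≼ ∩ ≽`, carrying the partial order `≼ / ≈`. -/
abbrev PiggyQuot (A : ISPAlg L M) : Type w :=
  Antisymmetrization (PiggyY hM A) (· ≤ ·)

/-- The quotient topology. -/
instance (A : ISPAlg L M) : TopologicalSpace (PiggyQuot hM A) :=
  TopologicalSpace.coinduced (toAntisymmetrization (α := PiggyY hM A) (· ≤ ·)) inferInstance

/-- The class `[(x, ω)]` in `Y_A / ≈`. -/
def PiggyQuot.mk {A : ISPAlg L M} (x : NatDual A) (ω : Omega hM) : PiggyQuot hM A :=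
  toAntisymmetrization (· ≤ ·) (PiggyY.mk hM x ω)

/-- `Y_A / ≈` with its order and topology satisfies the axioms of a Priestley space. -/
def PiggyQuot.IsPriestley (A : ISPAlg L M) : Prop :=
  CompactSpace (PiggyQuot hM A) ∧ PriestleySpace (PiggyQuot hM A)

/-- `Y_A / ≈` as an object of the category of Priestley spaces. -/
def PiggyQuot.toPriestley {A : ISPAlg L M} (hA : PiggyQuot.IsPriestley hM A) :
    PriestleyCat.{w} :=
  { carrier := PiggyQuot hM A
    compact := hA.1
    priestley := hA.2 }

end Piggyback

/-! Everything follows from the map `(x, ω) ↦ ω ∘ x` from `Y_A` to `HU(A)`. By `piggyLE_iff`, `≼` is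
the pullback of the pointwise order along it: the image of `A` under `a ↦ (x a, y a)` is a
subalgebra of `M²`, and by finiteness it lies in a maximal admissible one. So the map induces an
order embedding of `Y_A / ≈`.

It is onto by compactness. Its image is compact, because `D(A)` is closed in a power of the finite
set `M` and `Ω` is finite. Its image also determines the order of `A`: homomorphisms into `M`
separate the points of `A`, and by the prime ideal theorem `Ω` determines the order of `M`. By
`DualPoint.mem_of_isCompact_of_separating` a compact set with this property is the whole dual space.

A continuous bijection from a compact space to a Hausdorff one is a homeomorphism, so `Y_A / ≈` is
isomorphic to `HU(A)`, and functoriality is transported from `HU`. -/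

namespace DualPoint

variable {K : BddDistLat.{w}}

/-! ### Compact order-determining subsets of the dual of a lattice -/

theorem map_sup (p : DualPoint K) (a b : K) : p (a ⊔ b) = (p a ⊔ p b) :=
  (p : BoundedLatticeHom K Bool).map_sup' a b

theorem map_inf (p : DualPoint K) (a b : K) : p (a ⊓ b) = (p a ⊓ p b) :=
  (p : BoundedLatticeHom K Bool).map_inf' a b

theorem map_top (p : DualPoint K) : p ⊤ = true := BoundedLatticeHom.map_top' p

theorem map_bot (p : DualPoint K) : p ⊥ = false := BoundedLatticeHom.map_bot' p

/-- The bounded lattice homomorphism into `2` with kernel a given prime ideal. -/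
noncomputable def ofPrimeIdeal (J : Order.Ideal K) (hJ : J.IsPrime) : DualPoint K :=
  open Classical in
  ({ toFun := fun a => decide (a ∉ J)
     map_sup' := fun a b => by
      have h : a ⊔ b ∈ J ↔ a ∈ J ∧ b ∈ J := Order.Ideal.sup_mem_iff
      by_cases ha : a ∈ J <;> by_cases hb : b ∈ J <;> simp [h, ha, hb]
     map_inf' := fun a b => by
      have h : a ⊓ b ∈ J ↔ a ∈ J ∨ b ∈ J :=
        ⟨hJ.mem_or_mem, fun h => h.elim (J.lower inf_le_left) (J.lower inf_le_right)⟩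
      by_cases ha : a ∈ J <;> by_cases hb : b ∈ J <;> simp [h, ha, hb]
     map_top' := by simpa using hJ.top_notMem
     map_bot' := by simp } : BoundedLatticeHom K Bool)

theorem ofPrimeIdeal_apply_eq_true {J : Order.Ideal K} {hJ : J.IsPrime} {a : K} :
    ofPrimeIdeal J hJ a = true ↔ a ∉ J := by
  classical
  exact decide_eq_true_iff

/-- The homomorphisms of a bounded distributive lattice into `2` determine its order. -/
theorem le_of_forall_apply_le {a b : K} (h : ∀ p : DualPoint K, p a ≤ p b) : a ≤ b := by
  by_contra hab
  have hdisj : Disjoint (Order.PFilter.principal a : Set K) (Order.Ideal.principal b : Set K) :=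
    Set.disjoint_left.mpr fun c hac hcb =>
      hab ((Order.PFilter.mem_principal.mp hac).trans (Order.Ideal.mem_principal.mp hcb))
  obtain ⟨J, hJ, hbJ, haJ⟩ := DistribLattice.prime_ideal_of_disjoint_filter_ideal hdisj
  have ha : a ∉ J := Set.disjoint_left.mp haJ (Order.PFilter.mem_principal.mpr le_rfl)
  have hb : b ∈ J := hbJ (Order.Ideal.mem_principal.mpr le_rfl)
  have h1 := h (ofPrimeIdeal J hJ)
  rw [ofPrimeIdeal_apply_eq_true.mpr ha] at h1
  exact ofPrimeIdeal_apply_eq_true.mp (top_le_iff.mp h1) hb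

/-- A compact set of homomorphisms into `2` that determines the order contains all of them. -/
theorem mem_of_isCompact_of_separating {Z : Set (DualPoint K)} (hZ : IsCompact Z)
    (sep : ∀ a b : K, (∀ z ∈ Z, z a ≤ z b) → a ≤ b) (p : DualPoint K) : p ∈ Z := by
  by_contra hp
  -- Compactness gives a single pair `a`, `b` that `p` puts in the wrong order but all of `Z` puts
  -- in the right one. Local pairs combine by meeting the first entries and joining the second.
  obtain ⟨a, b, ha, hb, hab⟩ : ∃ a b : K, p a = true ∧ p b = false ∧ ∀ z ∈ Z, z a ≤ z b := by
    refine hZ.induction_on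
      (p := fun S => ∃ a b : K, p a = true ∧ p b = false ∧ ∀ z ∈ S, z a ≤ z b)
      ⟨⊤, ⊥, map_top p, map_bot p, fun z hz => hz.elim⟩ ?_ ?_ ?_
    · rintro S S' hS ⟨a, b, ha, hb, hab⟩
      exact ⟨a, b, ha, hb, fun z hz => hab z (hS hz)⟩
    · rintro S S' ⟨a, b, ha, hb, hab⟩ ⟨a', b', ha', hb', hab'⟩
      refine ⟨a ⊓ a', b ⊔ b', by simp [map_inf, ha, ha'], by simp [map_sup, hb, hb'], ?_⟩
      rintro z (hz | hz) <;> rw [map_inf, map_sup]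
      · exact inf_le_left.trans ((hab z hz).trans le_sup_left)
      · exact inf_le_right.trans ((hab' z hz).trans le_sup_right)
    · intro z hz
      have hne : z ≠ p := fun h => hp (h ▸ hz)
      obtain ⟨c, hc⟩ := DFunLike.ne_iff.mp hne
      have hnhds : {q : DualPoint K | q c = z c} ∈ nhdsWithin z Z :=
        mem_nhdsWithin_of_mem_nhds
          (((isOpen_discrete {z c}).preimage (continuous_eval K c)).mem_nhds rfl)
      -- Near `z` every `q` agrees with `z` at `c`, where `p` differs. The pair is `(⊤, c)` or `(c,
      -- ⊥)`, according to the value of `p` there.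
      cases hpc : p c
      · have hzc : z c = true := by simpa [hpc] using hc
        refine ⟨_, hnhds, ⊤, c, map_top p, hpc, fun q hq => ?_⟩
        rw [show q c = true from Eq.trans hq hzc]
        exact le_top
      · have hzc : z c = false := by simpa [hpc] using hc
        refine ⟨_, hnhds, c, ⊥, hpc, map_bot p, fun q hq => ?_⟩
        rw [show q c = false from Eq.trans hq hzc]
        exact bot_le
  have h : p a ≤ p b := sup_eq_right.mp (by rw [← map_sup, sup_eq_right.mpr (sep a b hab)])
  rw [ha, hb] at h
  exact absurd h (by decide)

end DualPoint

/-! ### Compactness of `Y_A` and surjectivity onto the dual -/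

section Piggyback

variable {L : FirstOrder.Language.{u, v}} {M : Type w} [L.Structure M]

/-- Without relation symbols, being a homomorphism is a family of equations between continuous
functions of `x`; each operation involves finitely many coordinates, so it is continuous for
discrete `M`. -/
theorem NatDual.isClosed_range [L.IsAlgebraic] [TopologicalSpace M] [DiscreteTopology M]
    (A : ISPAlg L M) : IsClosed (Set.range fun x : NatDual A => (x : A → M)) := by
  have h : (Set.range fun x : NatDual A => (x : A → M)) =
      ⋂ (n : ℕ) (f : L.Functions n) (a : Fin n → A),
        {x : A → M | x (FirstOrder.Language.Structure.funMap f a) =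
          FirstOrder.Language.Structure.funMap f fun i => x (a i)} := by
    ext x
    simp only [Set.mem_range, Set.mem_iInter, Set.mem_ofPred_eq]
    constructor
    · rintro ⟨x, rfl⟩ n f a
      exact FirstOrder.Language.Hom.map_fun x f a
    · intro hx
      exact ⟨({ toFun := x, map_fun' := fun f a => hx _ f a,
                map_rel' := fun r => isEmptyElim r } : A →[L] M), rfl⟩
  rw [h]
  refine isClosed_iInter fun n => isClosed_iInter fun f => isClosed_iInter fun a => ?_
  exact isClosed_eq (continuous_apply _)
    ((continuous_of_discreteTopology (f := fun c : Fin n → M =>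
      FirstOrder.Language.Structure.funMap f c)).comp
      (continuous_pi fun i => continuous_apply (a i)))

instance [L.IsAlgebraic] [Finite M] (A : ISPAlg L M) : CompactSpace (NatDual A) := by
  let : TopologicalSpace M := ⊥
  have : DiscreteTopology M := ⟨rfl⟩
  exact (Topology.IsClosedEmbedding.mk
    ⟨⟨rfl⟩, DFunLike.coe_injective⟩ (NatDual.isClosed_range A)).compactSpace

variable {T : LatticeTerms L} (hM : T.IsReduct M)

instance [Finite M] : Finite (Omega hM) :=
  Finite.of_injective (fun ω => (ω : M → Bool)) DFunLike.coe_injective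

instance [L.IsAlgebraic] [Finite M] (A : ISPAlg L M) : CompactSpace (PiggyY hM A) := by
  -- `Ω` already carries the pointwise topology as a `DualPoint`; the local instance selects the
  -- discrete one used to define `Y_A`.
  let : TopologicalSpace (Omega hM) := ⊥
  have : DiscreteTopology (Omega hM) := ⟨rfl⟩
  exact inferInstanceAs (CompactSpace (NatDual A × Omega hM))

theorem PiggyY.continuous_compOmega (A : ISPAlg L M) :
    Continuous fun y : PiggyY hM A => NatDual.compOmega hM y.1 y.2 := by
  let : TopologicalSpace M := ⊥
  have : DiscreteTopology M := ⟨rfl⟩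
  refine continuous_induced_rng.mpr (continuous_pi fun a => ?_)
  have hx : Continuous fun x : NatDual A => x a :=
    (continuous_apply a).comp continuous_induced_dom
  let : TopologicalSpace (Omega hM) := ⊥
  have : DiscreteTopology (Omega hM) := ⟨rfl⟩
  exact (continuous_of_discreteTopology (f := fun q : M × Omega hM => q.2 q.1)).comp
    ((hx.comp continuous_fst).prodMk continuous_snd)

/-- The order of an algebra in `ISP(M)` is determined by the maps `ω ∘ x`. -/
theorem ISPAlg.le_of_forall_compOmega_le (A : ISPAlg L M) (a b : (forgetU hM).obj A)
    (h : ∀ (x : NatDual A) (ω : Omega hM),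
      NatDual.compOmega hM x ω a ≤ NatDual.compOmega hM x ω b) : a ≤ b := by
  -- Homomorphisms into `M` only test equality, so the inequality is first turned into `a ⊔ b = b`.
  refine sup_eq_right.mp (A.separating _ _ fun x => ?_)
  let g : (forgetU hM).obj A ⟶ hM.toBddDistLat :=
    LatticeTerms.IsReduct.mapHom T (A.isReduct hM) hM x
  have hle : g a ≤ g b := DualPoint.le_of_forall_apply_le fun ω => h x ω
  exact (T.map_supOp x a b).trans (sup_eq_right.mpr hle)

variable [L.IsAlgebraic] [Finite M]

theorem PiggyY.le_iff_compOmega_le {A : ISPAlg L M} (y z : PiggyY hM A) :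
    y ≤ z ↔ NatDual.compOmega hM y.1 y.2 ≤ NatDual.compOmega hM z.1 z.2 :=
  piggyLE_iff hM y z

/-- The maps `ω ∘ x` form a compact set, as a continuous image of `Y_A`, and they determine the
order of `A`. -/
theorem NatDual.exists_compOmega_eq (A : ISPAlg L M) (p : DualPoint ((forgetU hM).obj A)) :
    ∃ y : PiggyY hM A, NatDual.compOmega hM y.1 y.2 = p :=
  DualPoint.mem_of_isCompact_of_separating
    (isCompact_range (PiggyY.continuous_compOmega hM A))
    (fun a b h => A.le_of_forall_compOmega_le hM a b fun x ω =>
      h _ ⟨PiggyY.mk hM x ω, rfl⟩) p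

/-! ### The isomorphism with the Priestley dual, and its naturality -/

namespace PiggyQuot

/-- The map `[(x, ω)] ↦ ω ∘ x`, as an order embedding. -/
noncomputable def compOmegaEmbedding (A : ISPAlg L M) :
    PiggyQuot hM A ↪o DualPoint ((forgetU hM).obj A) :=
  OrderEmbedding.ofMapLEIff
    (Quotient.lift (fun y : PiggyY hM A => NatDual.compOmega hM y.1 y.2) fun y z hyz =>
      le_antisymm ((PiggyY.le_iff_compOmega_le hM y z).mp hyz.1)
        ((PiggyY.le_iff_compOmega_le hM z y).mp hyz.2))
    (by
      rintro ⟨y⟩ ⟨z⟩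
      exact (PiggyY.le_iff_compOmega_le hM y z).symm)

theorem continuous_compOmegaEmbedding (A : ISPAlg L M) : Continuous (compOmegaEmbedding hM A) :=
  continuous_coinduced_dom.mpr (PiggyY.continuous_compOmega hM A)

theorem compOmegaEmbedding_surjective (A : ISPAlg L M) :
    Function.Surjective (compOmegaEmbedding hM A) := fun p => by
  obtain ⟨y, hy⟩ := NatDual.exists_compOmega_eq hM A p
  exact ⟨toAntisymmetrization (· ≤ ·) y, hy⟩

/-- Compactness descends along the quotient map; separating clopen upper sets are pulled back along
the embedding, for which surjectivity is not needed. -/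
theorem isPriestley (A : ISPAlg L M) : IsPriestley hM A := by
  refine ⟨⟨?_⟩, ⟨fun {p q} hpq => ?_⟩⟩
  · have h : Function.Surjective (toAntisymmetrization (α := PiggyY hM A) (· ≤ ·)) :=
      Quotient.mk_surjective
    exact h.range_eq ▸ isCompact_range continuous_coinduced_rng
  · obtain ⟨U, hU, hup, hp, hq⟩ := exists_isClopen_upper_of_not_le
      (mt (compOmegaEmbedding hM A).le_iff_le.mp hpq)
    exact ⟨_, hU.preimage (continuous_compOmegaEmbedding hM A),
      hup.preimage (compOmegaEmbedding hM A).monotone, hp, hq⟩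

/-- The map `[(x, ω)] ↦ ω ∘ x`, as an order isomorphism. -/
noncomputable def compOmegaOrderIso (A : ISPAlg L M) :
    PiggyQuot hM A ≃o DualPoint ((forgetU hM).obj A) :=
  RelIso.ofSurjective (compOmegaEmbedding hM A) (compOmegaEmbedding_surjective hM A)

theorem continuous_compOmegaOrderIso_symm (A : ISPAlg L M) :
    Continuous (compOmegaOrderIso hM A).symm :=
  haveI := (isPriestley hM A).1
  Continuous.continuous_symm_of_equiv_compact_to_t2 (f := (compOmegaOrderIso hM A).toEquiv)
    (continuous_compOmegaEmbedding hM A)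

/-- The map `[(x, ω)] ↦ ω ∘ x`, as a morphism of Priestley spaces. -/
noncomputable def compOmegaHom (A : ISPAlg L M) :
    PiggyQuot hM A →Co DualPoint ((forgetU hM).obj A) where
  toFun := compOmegaOrderIso hM A
  monotone' := (compOmegaOrderIso hM A).monotone
  continuous_toFun := continuous_compOmegaEmbedding hM A

/-- The inverse of `[(x, ω)] ↦ ω ∘ x`, as a morphism of Priestley spaces. -/
noncomputable def compOmegaInv (A : ISPAlg L M) :
    DualPoint ((forgetU hM).obj A) →Co PiggyQuot hM A where
  toFun := (compOmegaOrderIso hM A).symm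
  monotone' := (compOmegaOrderIso hM A).symm.monotone
  continuous_toFun := continuous_compOmegaOrderIso_symm hM A

/-- The map `[(x, ω)] ↦ ω ∘ x`, as an isomorphism of Priestley spaces. -/
noncomputable def compOmegaIso (A : ISPAlg L M) :
    toPriestley hM (isPriestley hM A) ≅ priestleyH.obj (op ((forgetU hM).obj A)) where
  hom := compOmegaHom hM A
  inv := compOmegaInv hM A
  hom_inv_id := ContinuousOrderHom.ext fun q : PiggyQuot hM A =>
    (compOmegaOrderIso hM A).symm_apply_apply q
  inv_hom_id := ContinuousOrderHom.ext fun p : DualPoint ((forgetU hM).obj A) =>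
    (compOmegaOrderIso hM A).apply_symm_apply p

theorem compOmegaIso_hom_mk {A : ISPAlg L M} (x : NatDual A) (ω : Omega hM) :
    (compOmegaIso hM A).hom (mk hM x ω) = NatDual.compOmega hM x ω := rfl

/-- The morphism `L(h) : L(B) → L(A)` induced by `h : A → B`. -/
noncomputable def map {A B : ISPAlg L M} (h : A ⟶ B) :
    toPriestley hM (isPriestley hM B) ⟶ toPriestley hM (isPriestley hM A) :=
  -- Conjugating `HU(h)` makes continuity, monotonicity and functoriality automatic; the formula on
  -- classes is then `map_mk`.
  (compOmegaIso hM B).hom ≫ priestleyH.map ((forgetU hM).map h).op ≫ (compOmegaIso hM A).inv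

/-- Since `(ω ∘ x) ∘ h` and `ω ∘ (x ∘ h)` agree definitionally, only the cancellation of an
isomorphism with its inverse remains. -/
theorem map_mk {A B : ISPAlg L M} (h : A ⟶ B) (x : NatDual B) (ω : Omega hM) :
    map hM h (mk hM x ω) = mk hM (NatDual.map h x) ω :=
  (compOmegaOrderIso hM A).symm_apply_apply (mk hM (NatDual.map h x) ω)

theorem map_id (A : ISPAlg L M) : map hM (𝟙 A) = 𝟙 (toPriestley hM (isPriestley hM A)) := by
  simp [map]

theorem map_comp {A B C : ISPAlg L M} (g : A ⟶ B) (h : B ⟶ C) :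
    map hM (g ≫ h) = map hM h ≫ map hM g := by
  simp [map]

end PiggyQuot

end Piggyback

theorem theorem6p1 (L : FirstOrder.Language.{u, v}) [L.IsAlgebraic]
    (M : Type w) [L.Structure M] [Finite M]
    (T : LatticeTerms L) (hM : T.IsReduct M) :
    ∃ (P : ∀ A : ISPAlg L M, PiggyQuot.IsPriestley hM A)
      (mapL : ∀ {A B : ISPAlg L M}, (A ⟶ B) →
        (PiggyQuot.toPriestley hM (P B) ⟶ PiggyQuot.toPriestley hM (P A)))
      (_ : ∀ {A B : ISPAlg L M} (h : A ⟶ B) (x : NatDual B) (ω : Omega hM),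
        mapL h (PiggyQuot.mk hM x ω) = PiggyQuot.mk hM (NatDual.map h x) ω)
      (map_id : ∀ A : ISPAlg L M, mapL (𝟙 A) = 𝟙 (PiggyQuot.toPriestley hM (P A)))
      (map_comp : ∀ {A B C : ISPAlg L M} (g : A ⟶ B) (h : B ⟶ C),
        mapL (g ≫ h) = mapL h ≫ mapL g),
      let functorL : (ISPAlg L M)ᵒᵖ ⥤ PriestleyCat.{w} :=
        { obj := fun A => PiggyQuot.toPriestley hM (P A.unop)
          map := fun f => mapL f.unop
          map_id := fun A => map_id A.unop
          map_comp := fun f g => map_comp g.unop f.unop }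
      ∃ Φ : functorL ≅ (forgetU hM).op ⋙ priestleyH,
        ∀ (A : ISPAlg L M) (x : NatDual A) (ω : Omega hM),
          Φ.hom.app (op A) (PiggyQuot.mk hM x ω) = NatDual.compOmega hM x ω := by
  refine ⟨PiggyQuot.isPriestley hM, PiggyQuot.map hM, PiggyQuot.map_mk hM, PiggyQuot.map_id hM,
    PiggyQuot.map_comp hM,
    NatIso.ofComponents (fun A => PiggyQuot.compOmegaIso hM A.unop) fun f => ?_,
    fun A x ω => PiggyQuot.compOmegaIso_hom_mk hM x ω⟩
  simp [PiggyQuot.map]
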